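/- Let $m\ge 2$ be an integer and put $n=2m-1$. Let $$h(x)=\sum_{k=0}^{m-1}\beta_k x^{2k},\qquad \beta_k=2\,\frac{(2m)(2m-2)\cdots(2m-2k)}{(2m-1)(2m-3)\cdots(2m-2k-1)},\quad 0\le k\le m-1.$$ For odd integers $q$ set $$I(q)=\frac{2}{\pi}\sin\frac{q\pi}{2}\int_{-1}^{1}\frac{\cos(q\arcsin x)}{h(x)(1-x^2)}\,dx=\frac4\pi\int_0^{\pi/2}\frac{\sin qs}{\sin s\;h(\cos s)}\,ds,\qquad Q(q)=I(q)+\frac1{2m}.$$ Define the $(m-1)\times(m-1)$ real matrices $Q^{[m-1]}$ and $B^{[m-1]}$ by $$Q^{[m-1]}_{ij}=Q(n-2i+2j),\qquad B^{[m-1]}_{ij}=2m\binom{n}{j-i},\qquad 1\le i,j\le m-1,$$ where $\binom nk=0$ for $k<0$, and let $$T^{[m-1]}=I-\frac{(m!)^2}{m\,(2m)!}\,Q^{[m-1]}B^{[m-1]},$$ where $I$ without an argument denotes the identity matrix. Then $$\det T^{[m-1]}\ \ge\ 0.0865 .$$ -/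

import Mathlib

noncomputable section

namespace LogGas

/-- The coefficient
`β_k = 2 * ((2m)(2m-2)⋯(2m-2k)) / ((2m-1)(2m-3)⋯(2m-2k-1))`. -/
def beta (m k : ℕ) : ℝ :=
  2 * ((∏ l ∈ Finset.range (k + 1), (2 * (m : ℝ) - 2 * (l : ℝ))) /
    ∏ l ∈ Finset.range (k + 1), (2 * (m : ℝ) - 2 * (l : ℝ) - 1))

/-- The polynomial function `h(x) = ∑_{k=0}^{m-1} β_k x^{2k}`. -/
def h (m : ℕ) (x : ℝ) : ℝ :=
  ∑ k ∈ Finset.range m, beta m k * x ^ (2 * k)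

/-- `I(q) = (2/π) sin(qπ/2) ∫_{-1}^1 cos(q arcsin x) / (h(x) (1 - x²)) dx`
(used for odd `q`, when the integral converges absolutely). -/
def I (m : ℕ) (q : ℤ) : ℝ :=
  2 / Real.pi * Real.sin ((q : ℝ) * Real.pi / 2) *
    ∫ x in (-1 : ℝ)..1, Real.cos ((q : ℝ) * Real.arcsin x) / (h m x * (1 - x ^ 2))

/-- `Q(q) = I(q) + 1/(2m)`. -/
def Q (m : ℕ) (q : ℤ) : ℝ :=
  I m q + 1 / (2 * (m : ℝ))

/-- The matrix with entries `Q(n - 2i + 2j)`, `1 ≤ i, j ≤ m - 1`, where `n = 2m - 1`.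
The indices of `Fin (m - 1)` start at `0`, so `i` and `j` are shifted by `1`. -/
def matQ (m : ℕ) : Matrix (Fin (m - 1)) (Fin (m - 1)) ℝ :=
  Matrix.of fun i j =>
    Q m ((2 * (m : ℤ) - 1) - 2 * (((i : ℕ) : ℤ) + 1) + 2 * (((j : ℕ) : ℤ) + 1))

/-- The matrix with entries `2m * C(n, j - i)`, `1 ≤ i, j ≤ m - 1`, where `n = 2m - 1` and
`C(n, k) = 0` for `k < 0` (the shift of the indices does not affect `j - i`). -/
def matB (m : ℕ) : Matrix (Fin (m - 1)) (Fin (m - 1)) ℝ :=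
  Matrix.of fun i j =>
    2 * (m : ℝ) *
      (if (i : ℕ) ≤ (j : ℕ) then ((Nat.choose (2 * m - 1) ((j : ℕ) - (i : ℕ)) : ℕ) : ℝ) else 0)

/-- `T = 1 - ((m!)² / (m (2m)!)) Q B`. -/
def matT (m : ℕ) : Matrix (Fin (m - 1)) (Fin (m - 1)) ℝ :=
  1 - (((Nat.factorial m : ℝ) ^ 2) / ((m : ℝ) * (Nat.factorial (2 * m) : ℝ))) •
    (matQ m * matB m)

theorem h_even (m : ℕ) (x : ℝ) : h m (-x) = h m x := by
  unfold h
  refine Finset.sum_congr rfl fun k _ => ?_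
  rw [pow_mul, pow_mul, neg_sq]

/-- The second integral formula for `I(q)`:
`I(q) = (4/π) ∫_0^{π/2} sin(qs) / (sin s * h(cos s)) ds` for odd `q`. -/
theorem I_eq (m : ℕ) (q : ℤ) (hq : Odd q) :
    I m q = 4 / Real.pi * ∫ s in (0 : ℝ)..(Real.pi / 2),
      Real.sin ((q : ℝ) * s) / (Real.sin s * h m (Real.cos s)) := by
  have hcq : Real.cos ((q : ℝ) * Real.pi / 2) = 0 := by
    obtain ⟨k, rfl⟩ := hq
    rw [Real.cos_eq_zero_iff]
    exact ⟨k, by push_cast; ring⟩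
  have hsq : Real.sin ((q : ℝ) * Real.pi / 2) ^ 2 = 1 := by
    have := Real.sin_sq_add_cos_sq ((q : ℝ) * Real.pi / 2)
    rw [hcq] at this
    simpa using this
  set S := Real.sin ((q : ℝ) * Real.pi / 2) with hS
  set g : ℝ → ℝ := fun s => Real.sin ((q : ℝ) * s) / (Real.sin s * h m (Real.cos s)) with hg
  have hpi := Real.pi_pos
  have himg : Real.cos '' Set.Ioo 0 Real.pi = Set.Ioo (-1) 1 := by
    ext x
    constructor
    · rintro ⟨s, ⟨h0, h1⟩, rfl⟩
      constructor
      · rw [← Real.cos_pi]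
        exact Real.cos_lt_cos_of_nonneg_of_le_pi h0.le le_rfl h1
      · rw [← Real.cos_zero]
        exact Real.cos_lt_cos_of_nonneg_of_le_pi le_rfl h1.le h0
    · rintro ⟨h0, h1⟩
      refine ⟨Real.arccos x, ⟨Real.arccos_pos.2 h1, ?_⟩, Real.cos_arccos h0.le h1.le⟩
      exact lt_of_le_of_ne (Real.arccos_le_pi x) fun he => by
        have := Real.arccos_eq_pi.1 he
        linarith
  have hchange : (∫ x in (-1 : ℝ)..1,
      Real.cos ((q : ℝ) * Real.arcsin x) / (h m x * (1 - x ^ 2))) =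
      S * ∫ s in (0 : ℝ)..Real.pi, g s := by
    rw [intervalIntegral.integral_of_le (by norm_num), intervalIntegral.integral_of_le hpi.le,
      MeasureTheory.integral_Ioc_eq_integral_Ioo, MeasureTheory.integral_Ioc_eq_integral_Ioo,
      ← himg, MeasureTheory.integral_image_eq_integral_abs_deriv_smul measurableSet_Ioo
        (fun s _ => (Real.hasDerivAt_cos s).hasDerivWithinAt)
        (Real.injOn_cos.mono Set.Ioo_subset_Icc_self),
      ← MeasureTheory.integral_const_mul]
    refine MeasureTheory.setIntegral_congr_fun measurableSet_Ioo fun s hs => ?_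
    have hsin : 0 < Real.sin s := Real.sin_pos_of_pos_of_lt_pi hs.1 hs.2
    have harc : Real.arcsin (Real.cos s) = Real.pi / 2 - s := by
      rw [← Real.sin_pi_div_two_sub]
      exact Real.arcsin_sin (by linarith [hs.2]) (by linarith [hs.1])
    have hcos : Real.cos ((q : ℝ) * (Real.pi / 2 - s)) = S * Real.sin ((q : ℝ) * s) := by
      rw [mul_sub, ← mul_div_assoc, Real.cos_sub, hcq, hS]
      ring
    have hone : 1 - Real.cos s ^ 2 = Real.sin s ^ 2 := by
      rw [Real.sin_sq]
    simp only [hg, smul_eq_mul, abs_neg, abs_of_pos hsin]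
    rw [harc, hcos, hone, mul_div_assoc', mul_div_assoc']
    rcases eq_or_ne (h m (Real.cos s)) 0 with h0 | h0
    · simp [h0]
    · field_simp
  have hsymm : ∀ s, g (Real.pi - s) = g s := by
    intro s
    have h1 : Real.sin ((q : ℝ) * (Real.pi - s)) = Real.sin ((q : ℝ) * s) := by
      have e : (q : ℝ) * (Real.pi - s) =
          2 * ((q : ℝ) * Real.pi / 2) - (q : ℝ) * s := by ring
      rw [e, Real.sin_sub, Real.sin_two_mul, Real.cos_two_mul, hcq]
      ring
    simp only [hg]
    rw [h1, Real.sin_pi_sub, Real.cos_pi_sub, h_even]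
  have hhalf : (∫ s in (Real.pi / 2)..Real.pi, g s) = ∫ s in (0 : ℝ)..(Real.pi / 2), g s := by
    have := intervalIntegral.integral_comp_sub_left (a := 0) (b := Real.pi / 2) g Real.pi
    simp only [hsymm] at this
    rw [this]
    congr 1 <;> ring
  have htwo : (∫ s in (0 : ℝ)..Real.pi, g s) = 2 * ∫ s in (0 : ℝ)..(Real.pi / 2), g s := by
    by_cases hi : IntervalIntegrable g MeasureTheory.volume 0 (Real.pi / 2)
    · have hi' : IntervalIntegrable g MeasureTheory.volume (Real.pi / 2) Real.pi := by
        have := (hi.comp_sub_left Real.pi).symm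
        simp only [hsymm] at this
        convert this using 1 <;> ring
      rw [← intervalIntegral.integral_add_adjacent_intervals hi hi', hhalf]
      ring
    · rw [intervalIntegral.integral_undef hi, intervalIntegral.integral_undef, mul_zero]
      intro hc
      exact hi (hc.mono_set (by
        rw [Set.uIcc_of_le hpi.le, Set.uIcc_of_le (by linarith)]
        exact Set.Icc_subset_Icc_right (by linarith)))
  unfold I
  rw [hchange, htwo]
  calc 2 / Real.pi * S * (S * (2 * ∫ s in (0 : ℝ)..(Real.pi / 2), g s))
      = S ^ 2 * (4 / Real.pi * ∫ s in (0 : ℝ)..(Real.pi / 2), g s) := by ring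
    _ = _ := by rw [hsq, one_mul]

end LogGas

end

/-! The matrix `1 - T` is so small that a crude determinant bound suffices: if `|K i j| ≤ w j`, then
`det (1 - K) ≥ 1 - ∑ w j`. Here `w j` is a uniform bound `1.827 / m` on `|Q|` times the scaled
column sums of `B`. The sum of all entries of `B` is at most `(m² / 2) * C(2m, m)`, so everything
cancels to `∑ w j ≤ 1.827 / 2 = 0.9135 = 1 - 0.0865`.

The bound on `Q` is the analytic core. Write `h(x) = H(x²)` and `φ(u) = 4m / H(1 - u) - 2mu`. The
recurrence for `β_k` gives a linear ODE for `H`, hence a Riccati equation for `φ`. The term `2mu`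
contributes nothing to `I(2p+1)` when `p ≥ 1`, and integration by parts cancels the summand `1 /
(2m)`, so `Q(2p+1) = -(1 / (πm)) ∫ S_p(s) (φ(sin² s))' ds`, where `S_p` is the primitive of the
Dirichlet kernel. Since `0 ≤ S_p ≤ π/2 + 2/π` (`dirichletInt_mem_Icc`), and `φ` falls from `1` to a
minimum at least `-1.6` and then rises to `-1` (`exists_unimodal`, `neg_le`), the integral is at
most `2.6 (π/2 + 2/π) ≤ 1.827 π` in absolute value (`abs_Q_le`). -/

/-! ### Determinants of small perturbations of the identity. -/

/-- A real matrix whose entries are dominated in absolute value by those of the rank-one matrix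
with constant columns `w j` satisfies `det (1 - K) ≥ 1 - ∑ w j`. -/
theorem Matrix.one_sub_sum_le_det_one_sub (n : ℕ) :
    ∀ (K : Matrix (Fin n) (Fin n) ℝ) (w : Fin n → ℝ), (∀ i j, |K i j| ≤ w j) →
      ∑ j, w j < 1 → 1 - ∑ j, w j ≤ (1 - K).det := by
  induction n with
  | zero => intro K w _ _; simp
  | succ n ih =>
    intro K w hK hw
    rw [Fin.sum_univ_succ] at hw ⊢
    have hw0 : ∀ j, 0 ≤ w j := fun j => (abs_nonneg _).trans (hK 0 j)
    have hs : 0 ≤ ∑ j : Fin n, w j.succ := Finset.sum_nonneg fun j _ => hw0 _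
    have hp : 0 < 1 - w 0 := by linarith
    have hd : 1 - w 0 ≤ 1 - K 0 0 := by linarith [le_abs_self (K 0 0), hK 0 0]
    have hd0 : 0 < 1 - K 0 0 := hp.trans_le hd
    let e : Fin (n + 1) ≃ Fin n ⊕ Unit :=
      (finSuccEquiv n).trans (Equiv.optionEquivSumPUnit (Fin n))
    have hei : ∀ i, e.symm (Sum.inl i) = Fin.succ i := fun i => by simp [e]
    have her : ∀ u, e.symm (Sum.inr u) = 0 := fun i => by simp [e]
    -- Schur complement of the entry `(0, 0)`. It is again of the form `1 - K'`, with `w j` replaced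
    -- by `w j + w 0 * w j / (1 - w 0) = w j / (1 - w 0)`.
    let K' : Matrix (Fin n) (Fin n) ℝ := Matrix.of fun i j =>
      K i.succ j.succ + K i.succ 0 * K 0 j.succ / (1 - K 0 0)
    let D : Matrix Unit Unit ℝ := Matrix.of fun _ _ => 1 - K 0 0
    let _ : Invertible D := ⟨Matrix.of fun _ _ => (1 - K 0 0)⁻¹,
      by ext; simp [D, Matrix.mul_apply, hd0.ne'], by ext; simp [D, Matrix.mul_apply, hd0.ne']⟩
    have hblock : (1 - K).submatrix e.symm e.symm =
        Matrix.fromBlocks (Matrix.of fun i j : Fin n => (1 - K) i.succ j.succ)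
          (Matrix.of fun i _ => -K i.succ 0) (Matrix.of fun _ j => -K 0 j.succ) D := by
      ext i j
      rcases i with i | i <;> rcases j with j | j <;>
        simp [hei, her, D, Matrix.submatrix_apply, (Fin.succ_ne_zero _).symm]
    have hdet : (1 - K).det = (1 - K 0 0) * (1 - K').det := by
      rw [← Matrix.det_submatrix_equiv_self e.symm, hblock, Matrix.det_fromBlocks₂₂,
        Matrix.det_unique]
      refine congrArg₂ _ rfl (congrArg Matrix.det ?_)
      ext i j
      have : (⅟D : Matrix Unit Unit ℝ) = Matrix.of fun _ _ => (1 - K 0 0)⁻¹ := rfl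
      simp [this, K', Matrix.mul_apply, Matrix.one_apply]
      ring
    have hK' : ∀ i j, |K' i j| ≤ w j.succ / (1 - w 0) := by
      intro i j
      have h1 : |K i.succ 0 * K 0 j.succ / (1 - K 0 0)| ≤ w 0 * w j.succ / (1 - w 0) := by
        rw [abs_div, abs_mul, abs_of_pos hd0]
        exact div_le_div₀ (mul_nonneg (hw0 _) (hw0 _))
          (mul_le_mul (hK _ _) (hK _ _) (abs_nonneg _) (hw0 _)) hp hd
      calc |K' i j| ≤ |K i.succ j.succ| + |K i.succ 0 * K 0 j.succ / (1 - K 0 0)| := abs_add_le _ _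
        _ ≤ w j.succ + w 0 * w j.succ / (1 - w 0) := add_le_add (hK _ _) h1
        _ = _ := by field_simp; ring
    have hsum : ∑ j : Fin n, w j.succ / (1 - w 0) = (∑ j : Fin n, w j.succ) / (1 - w 0) :=
      (Finset.sum_div _ _ _).symm
    have hi := ih K' _ hK' (by rw [hsum, div_lt_one hp]; linarith)
    rw [hsum] at hi
    rw [hdet]
    have h0 : 0 ≤ 1 - (∑ j : Fin n, w j.succ) / (1 - w 0) := by
      rw [sub_nonneg, div_le_one hp]; linarith
    calc 1 - (w 0 + ∑ j : Fin n, w j.succ)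
        = (1 - w 0) * (1 - (∑ j : Fin n, w j.succ) / (1 - w 0)) := by field_simp; ring
      _ ≤ (1 - K 0 0) * (1 - (∑ j : Fin n, w j.succ) / (1 - w 0)) := by gcongr
      _ ≤ _ := by gcongr

/-! ### Partial sums of binomial coefficients. -/

/-- The sum telescopes: `(n - 2k) C(n,k) = (k+1) C(n,k+1) - k C(n,k)`. -/
theorem Nat.sum_range_sub_two_mul_choose (n j : ℕ) (hj : j ≤ n) :
    ∑ k ∈ Finset.range j, ((n : ℝ) - 2 * k) * (n.choose k : ℝ) = j * (n.choose j : ℝ) := by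
  induction j with
  | zero => simp
  | succ j ih =>
    rw [Finset.sum_range_succ, ih (by omega)]
    have h := congrArg (Nat.cast (R := ℝ)) (Nat.choose_succ_right_eq n j)
    push_cast [Nat.cast_sub (show j ≤ n by omega)] at h
    push_cast
    linarith

/-- Exchanging the sums gives `C(2m-1, k)` the weight `m - 1 - k`, which is below half of the
telescoping weight `2m - 1 - 2k`. -/
theorem Nat.sum_range_sum_range_choose_le (m : ℕ) (hm : 1 ≤ m) :
    ∑ j ∈ Finset.range (m - 1), ∑ k ∈ Finset.range (j + 1), ((2 * m - 1).choose k : ℝ) ≤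
      m / 4 * ((2 * m).choose m : ℝ) := by
  obtain ⟨p, rfl⟩ : ∃ p, m = p + 1 := ⟨m - 1, by omega⟩
  have h1 : 2 * (p + 1) - 1 = 2 * p + 1 := by omega
  rw [h1, Nat.add_sub_cancel]
  have key : ∀ (a : ℕ → ℝ) (N : ℕ), ∑ j ∈ Finset.range N, ∑ k ∈ Finset.range (j + 1), a k =
      ∑ k ∈ Finset.range (N + 1), ((N : ℝ) - k) * a k := by
    intro a N
    induction N with
    | zero => simp
    | succ N ih =>
      rw [Finset.sum_range_succ, ih, Finset.sum_range_succ _ (N + 1), ← Finset.sum_add_distrib]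
      push_cast
      rw [sub_self, zero_mul, add_zero]
      exact Finset.sum_congr rfl fun k _ => by ring
  rw [key]
  have h2 := Nat.sum_range_sub_two_mul_choose (2 * p + 1) (p + 1) (by omega)
  have h3 : ((2 * (p + 1)).choose (p + 1) : ℝ) = 2 * ((2 * p + 1).choose (p + 1) : ℝ) := by
    have := Nat.choose_succ_succ (2 * p + 1) p
    have h4 := Nat.choose_symm_half p
    rw [← h4] at this
    rw [show 2 * (p + 1) = (2 * p + 1).succ by omega, this]
    push_cast; ring
  rw [h3]
  calc ∑ k ∈ Finset.range (p + 1), ((p : ℝ) - k) * ((2 * p + 1).choose k : ℝ)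
      ≤ ∑ k ∈ Finset.range (p + 1),
        1 / 2 * ((((2 * p + 1 : ℕ) : ℝ) - 2 * k) * ((2 * p + 1).choose k : ℝ)) := by
        refine Finset.sum_le_sum fun k _ => ?_
        push_cast
        nlinarith [Nat.cast_nonneg (α := ℝ) ((2 * p + 1).choose k)]
    _ = _ := by
        rw [← Finset.mul_sum, h2]
        push_cast; ring

/-! ### The polynomial behind `h` and its differential equation. -/

namespace LogGas

/-- The polynomial in `y = x ^ 2` underlying `h`, truncated to `K` terms. -/
noncomputable def hPoly (m K : ℕ) : Polynomial ℝ :=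
  ∑ k ∈ Finset.range K, Polynomial.C (beta m k) * Polynomial.X ^ k

theorem h_eq_eval_hPoly (m : ℕ) (x : ℝ) : h m x = (hPoly m m).eval (x ^ 2) := by
  simp [h, hPoly, Polynomial.eval_finsetSum, pow_mul]

theorem two_mul_sub_sub_one_pos {m k : ℕ} (hk : k < m) : (0 : ℝ) < 2 * m - 2 * k - 1 := by
  have : (k : ℝ) + 1 ≤ m := by exact_mod_cast hk
  linarith

theorem beta_pos {m k : ℕ} (hk : k < m) : 0 < beta m k := by
  unfold beta
  refine mul_pos two_pos (div_pos ?_ ?_) <;> refine Finset.prod_pos fun l hl => ?_ <;>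
    have := two_mul_sub_sub_one_pos (m := m) (k := l) (by have := Finset.mem_range.1 hl; omega)
  · linarith
  · exact this

theorem beta_zero (m : ℕ) : beta m 0 = 4 * m / (2 * m - 1) := by
  simp [beta]; ring

theorem beta_succ {m k : ℕ} (hk : k + 1 < m) :
    (2 * (m : ℝ) - 2 * (k + 1) - 1) * beta m (k + 1) = (2 * m - 2 * (k + 1)) * beta m k := by
  have h1 : (2 * (m : ℝ) - 2 * (k + 1) - 1) ≠ 0 := by
    have := (two_mul_sub_sub_one_pos hk).ne'
    push_cast at this; exact this
  unfold beta
  rw [Finset.prod_range_succ _ (k + 1), Finset.prod_range_succ _ (k + 1)]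
  push_cast
  have h2 : ∏ l ∈ Finset.range (k + 1), (2 * (m : ℝ) - 2 * (l : ℝ) - 1) ≠ 0 :=
    Finset.prod_ne_zero_iff.2 fun l hl =>
      (two_mul_sub_sub_one_pos (by have := Finset.mem_range.1 hl; omega)).ne'
  generalize ∏ l ∈ Finset.range (k + 1), (2 * (m : ℝ) - 2 * (l : ℝ) - 1) = q at h2 ⊢
  generalize ∏ l ∈ Finset.range (k + 1), (2 * (m : ℝ) - 2 * (l : ℝ)) = p
  generalize 2 * (m : ℝ) - 2 * (k + 1) - 1 = a at h1 ⊢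
  field_simp

theorem hPoly_eval_pos {m : ℕ} (hm : 0 < m) {y : ℝ} (hy : 0 ≤ y) : 0 < (hPoly m m).eval y := by
  simp only [hPoly, Polynomial.eval_finsetSum, Polynomial.eval_mul, Polynomial.eval_C,
    Polynomial.eval_pow, Polynomial.eval_X]
  refine Finset.sum_pos' (fun k hk => mul_nonneg (beta_pos (Finset.mem_range.1 hk)).le
    (pow_nonneg hy k)) ⟨0, Finset.mem_range.2 hm, ?_⟩
  simpa using beta_pos hm

/-- Truncation makes induction on the number of terms possible. The error term, with factor `2m -
2(K+1)`, vanishes for the full polynomial `K + 1 = m`. -/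
theorem hPoly_truncated_ode {m K : ℕ} (hK : K + 1 ≤ m) (y : ℝ) :
    2 * y * (1 - y) * (hPoly m (K + 1)).derivative.eval y =
      ((2 * m - 2) * (1 - y) + 1) * (hPoly m (K + 1)).eval y - 4 * m +
        (2 * m - 2 * (K + 1)) * beta m K * y ^ (K + 1) := by
  induction K with
  | zero =>
    have h1 : (2 * (m : ℝ) - 1) ≠ 0 := by
      have := two_mul_sub_sub_one_pos (m := m) (k := 0) hK
      rw [Nat.cast_zero, mul_zero, sub_zero] at this; exact this.ne'
    simp [hPoly, beta_zero]
    field_simp; ring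
  | succ K ih =>
    have h1 := ih (by omega)
    have h2 := beta_succ (m := m) (k := K) (by omega)
    have hs : hPoly m (K + 1 + 1) = hPoly m (K + 1) +
      Polynomial.C (beta m (K + 1)) * Polynomial.X ^ (K + 1) := Finset.sum_range_succ _ _
    rw [hs]
    simp only [Polynomial.derivative_add, Polynomial.derivative_C_mul, Polynomial.eval_add,
      Polynomial.eval_mul, Polynomial.eval_C, Polynomial.eval_pow, Polynomial.eval_X,
      Polynomial.derivative_X_pow, Nat.add_sub_cancel]
    push_cast
    linear_combination h1 - y ^ (K + 1) * h2

theorem hPoly_ode {m : ℕ} (hm : 0 < m) (y : ℝ) :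
    2 * y * (1 - y) * (hPoly m m).derivative.eval y =
      ((2 * m - 2) * (1 - y) + 1) * (hPoly m m).eval y - 4 * m := by
  obtain ⟨K, rfl⟩ : ∃ K, m = K + 1 := ⟨m - 1, by omega⟩
  rw [hPoly_truncated_ode le_rfl y]
  push_cast; ring

end LogGas

/-! ### Shape and lower bound of solutions of the Riccati equation. -/

namespace LogGas

open Set

/-- The functions `φ`, `d = φ'`, `d' = φ''` on `[0, 1]`, where `φ` solves the singular Riccati
equation `2u(1-u)φ' = -(2mu(1+φ) + φ² + 2uφ - φ)` with boundary values `φ 0 = 1`, `φ 1 = -1`. -/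
structure RiccatiSolution (m : ℝ) (φ d d' : ℝ → ℝ) : Prop where
  two_le : 2 ≤ m
  hasDerivAt : ∀ u ∈ Icc (0 : ℝ) 1, HasDerivAt φ (d u) u
  hasDerivAt_deriv : ∀ u ∈ Icc (0 : ℝ) 1, HasDerivAt d (d' u) u
  zero : φ 0 = 1
  one : φ 1 = -1
  ode : ∀ u ∈ Icc (0 : ℝ) 1,
    2 * u * (1 - u) * d u = -(2 * m * u * (1 + φ u) + φ u ^ 2 + 2 * u * φ u - φ u)

namespace RiccatiSolution

variable {m : ℝ} {φ d d' : ℝ → ℝ}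

/-- At a critical point this reads `2u(1-u)φ'' = -2(m + (m+1)φ)`, so the level `-m/(m+1)` decides
the sign of `φ''`. -/
theorem deriv_ode (hs : RiccatiSolution m φ d d') {u : ℝ} (hu : u ∈ Icc (0 : ℝ) 1) :
    2 * (1 - 2 * u) * d u + 2 * u * (1 - u) * d' u =
      -(2 * m * (1 + φ u) + 2 * m * u * d u + 2 * φ u * d u + 2 * φ u + 2 * u * d u - d u) := by
  have hφ := (hs.hasDerivAt u hu).hasDerivWithinAt (s := Icc 0 1)
  have hd := (hs.hasDerivAt_deriv u hu).hasDerivWithinAt (s := Icc 0 1)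
  have hi := hasDerivWithinAt_id u (Icc (0 : ℝ) 1)
  have h1 := ((hi.const_mul 2).mul (hi.const_sub 1)).mul hd
  have h2 := ((((hi.const_mul (2 * m)).mul (hφ.const_add 1)).add (hφ.pow 2)).add
    ((hi.const_mul 2).mul hφ)).sub hφ |>.neg
  have h3 := h2.congr (f₁ := fun u => 2 * u * (1 - u) * d u) (fun x hx => by simpa using hs.ode x hx)
    (by simpa using hs.ode u hu)
  have h4 := (uniqueDiffOn_Icc (zero_lt_one' ℝ) u hu).eq_deriv _ h1 h3
  simp at h4
  linear_combination h4

theorem continuousOn (hs : RiccatiSolution m φ d d') {a b : ℝ} (ha : 0 ≤ a) (hb : b ≤ 1) :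
    ContinuousOn φ (Icc a b) := fun u hu =>
  (hs.hasDerivAt u ⟨ha.trans hu.1, hu.2.trans hb⟩).continuousAt.continuousWithinAt

theorem continuousOn_deriv (hs : RiccatiSolution m φ d d') {a b : ℝ} (ha : 0 ≤ a) (hb : b ≤ 1) :
    ContinuousOn d (Icc a b) := fun u hu =>
  (hs.hasDerivAt_deriv u ⟨ha.trans hu.1, hu.2.trans hb⟩).continuousAt.continuousWithinAt

/-- At this level the terms linear in `u` on the right of the Riccati equation cancel, leaving `φ -
φ² < 0`. The level can thus only be crossed downwards. -/
theorem deriv_neg_of_eq (hs : RiccatiSolution m φ d d') {u : ℝ} (hu : u ∈ Ico (0 : ℝ) 1)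
    (h : φ u = -(m / (m + 1))) : d u < 0 := by
  have hm := hs.two_le
  have hθ : 0 < m / (m + 1) := by positivity
  have hu0 : 0 < u := by
    rcases hu.1.eq_or_lt with h0 | h0
    · rw [← h0, hs.zero] at h; linarith
    · exact h0
  have hode := hs.ode u ⟨hu.1, hu.2.le⟩
  rw [h] at hode
  have hc : m - (m + 1) * (m / (m + 1)) = 0 := by field_simp; ring
  set θ := m / (m + 1)
  have : 2 * u * (1 - u) * d u = -(θ * (θ + 1)) := by
    linear_combination hode - 2 * u * hc
  by_contra hcon
  have h1 : 0 ≤ 2 * u * (1 - u) * d u :=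
    mul_nonneg (mul_nonneg (by linarith) (by linarith [hu.2])) (not_lt.1 hcon)
  nlinarith

theorem le_of_le (hs : RiccatiSolution m φ d d') {a : ℝ} (ha : 0 ≤ a)
    (h : φ a ≤ -(m / (m + 1))) {u : ℝ} (hu : u ∈ Icc a 1) : φ u ≤ -(m / (m + 1)) :=
  image_le_of_deriv_right_lt_deriv_boundary (hs.continuousOn ha le_rfl)
    (fun x hx => (hs.hasDerivAt x ⟨ha.trans hx.1, hx.2.le⟩).hasDerivWithinAt)
    (B := fun _ => -(m / (m + 1))) (B' := fun _ => 0) h (fun _ => hasDerivAt_const _ _)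
    (fun _ hx he => hs.deriv_neg_of_eq ⟨ha.trans hx.1, hx.2⟩ he) hu

theorem deriv_nonneg_of_le (hs : RiccatiSolution m φ d d') {a : ℝ} (ha : 0 < a)
    (h : φ a ≤ -(m / (m + 1))) (hd : 0 ≤ d a) {u : ℝ} (hu : u ∈ Icc a 1) : 0 ≤ d u := by
  have hm := hs.two_le
  refine neg_nonpos.1 (image_le_of_deriv_right_lt_deriv_boundary (f := fun x => -d x)
    (f' := fun x => -d' x) (hs.continuousOn_deriv ha.le le_rfl).neg
    (fun x hx => (hs.hasDerivAt_deriv x ⟨ha.le.trans hx.1, hx.2.le⟩).neg.hasDerivWithinAt)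
    (B := fun _ => 0) (B' := fun _ => 0) (neg_nonpos.2 hd) (fun _ => hasDerivAt_const _ _)
    (fun x hx he => ?_) hu)
  have hx0 : 0 < x := ha.trans_le hx.1
  have hdx : d x = 0 := neg_eq_zero.1 he
  have hlt : φ x < -(m / (m + 1)) :=
    lt_of_le_of_ne (hs.le_of_le ha.le h ⟨hx.1, hx.2.le⟩) fun h' =>
      (hs.deriv_neg_of_eq ⟨hx0.le, hx.2⟩ h').ne hdx
  have hode := hs.deriv_ode ⟨hx0.le, hx.2.le⟩
  rw [hdx] at hode
  have h1 : (m + 1) * φ x < -m := by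
    rw [← neg_div, lt_div_iff₀ (by linarith)] at hlt; linarith
  have h2 : 0 < 2 * x * (1 - x) * d' x := by linarith
  have h3 : 0 < 2 * x * (1 - x) := mul_pos (by linarith) (by linarith [hx.2])
  exact neg_neg_of_pos (pos_of_mul_pos_right h2 h3.le)

theorem deriv_nonpos_of_lt (hs : RiccatiSolution m φ d d') {a : ℝ} (ha : a ≤ 1)
    (h : ∀ u ∈ Icc 0 a, -(m / (m + 1)) < φ u) {u : ℝ} (hu : u ∈ Icc 0 a) : d u ≤ 0 := by
  have hm := hs.two_le
  have hd0 : d 0 < 0 := by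
    have := hs.deriv_ode (left_mem_Icc.2 zero_le_one)
    rw [hs.zero] at this
    linarith
  refine image_le_of_deriv_right_lt_deriv_boundary (f' := d')
    (hs.continuousOn_deriv le_rfl ha)
    (fun x hx => (hs.hasDerivAt_deriv x ⟨hx.1, hx.2.le.trans ha⟩).hasDerivWithinAt)
    (B := fun _ => 0) (B' := fun _ => 0) hd0.le (fun _ => hasDerivAt_const _ _)
    (fun x hx he => ?_) hu
  have hx0 : 0 < x := by
    rcases hx.1.eq_or_lt with h0 | h0
    · rw [← h0] at he; exact absurd he hd0.ne
    · exact h0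
  have hdx : d x = 0 := he
  have hlt := h x ⟨hx.1, hx.2.le⟩
  have hode := hs.deriv_ode ⟨hx0.le, hx.2.le.trans ha⟩
  rw [hdx] at hode
  have h1 : -m < (m + 1) * φ x := by
    rw [← neg_div, div_lt_iff₀ (by linarith)] at hlt; linarith
  have h2 : 0 < 2 * x * (1 - x) * (-d' x) := by linarith
  have h3 : 0 < 2 * x * (1 - x) := mul_pos (by linarith) (by linarith [hx.2])
  linarith [pos_of_mul_pos_right h2 h3.le]

/-- A solution first decreases and then increases. -/
theorem exists_unimodal (hs : RiccatiSolution m φ d d') :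
    ∃ u₀ ∈ Icc (0 : ℝ) 1, (∀ u ∈ Ioo 0 u₀, d u ≤ 0) ∧ ∀ u ∈ Ioo u₀ 1, 0 ≤ d u := by
  have hm := hs.two_le
  obtain ⟨u₀, hu₀, hmin⟩ := isCompact_Icc.exists_isMinOn (nonempty_Icc.2 (zero_le_one' ℝ))
    (hs.continuousOn le_rfl le_rfl)
  have hθ1 : m / (m + 1) ≤ 1 := by rw [div_le_one (by linarith)]; linarith
  have hle : φ u₀ ≤ -(m / (m + 1)) := by
    have := hmin (right_mem_Icc.2 (zero_le_one' ℝ))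
    simp only [mem_ofPred_eq, hs.one] at this
    linarith
  have h0 : 0 < u₀ := by
    rcases hu₀.1.eq_or_lt with h0 | h0
    · have : 0 < m / (m + 1) := by positivity
      rw [← h0, hs.zero] at hle; linarith
    · exact h0
  -- The turning point is a global minimizer. If `d v > 0` before it with `φ v` at or below the
  -- level, `φ` would be monotone up to its minimum, hence constant; with `φ v` above the level, so
  -- is all of `[0, v]`, which forces `d v ≤ 0`.
  refine ⟨u₀, hu₀, fun v hv => ?_, fun u hu => ?_⟩
  · by_contra! hdv
    have hv1 : v ≤ 1 := hv.2.le.trans hu₀.2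
    by_cases hφv : φ v ≤ -(m / (m + 1))
    · have hmono : MonotoneOn φ (Icc v u₀) := by
        refine monotoneOn_of_deriv_nonneg (convex_Icc _ _) (hs.continuousOn hv.1.le hu₀.2) ?_ ?_
        · intro x hx
          rw [interior_Icc] at hx
          exact (hs.hasDerivAt x
            ⟨hv.1.le.trans hx.1.le, hx.2.le.trans hu₀.2⟩).differentiableAt.differentiableWithinAt
        · intro x hx
          rw [interior_Icc] at hx
          rw [(hs.hasDerivAt x ⟨hv.1.le.trans hx.1.le, hx.2.le.trans hu₀.2⟩).deriv]
          exact hs.deriv_nonneg_of_le hv.1 hφv hdv.le ⟨hx.1.le, hx.2.le.trans hu₀.2⟩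
      have hconst : ∀ x ∈ Icc v u₀, φ x = φ v := fun x hx => by
        refine le_antisymm ?_ (hmono (left_mem_Icc.2 hv.2.le) hx hx.1)
        exact (hmono hx (right_mem_Icc.2 hv.2.le) hx.2).trans (hmin ⟨hv.1.le, hv1⟩)
      have h1 := (hs.hasDerivAt v ⟨hv.1.le, hv1⟩).hasDerivWithinAt (s := Icc v u₀)
      have h2 := (hasDerivWithinAt_const v (Icc v u₀) (φ v)).congr hconst rfl
      have := (uniqueDiffOn_Icc hv.2 v (left_mem_Icc.2 hv.2.le)).eq_deriv _ h1 h2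
      linarith
    · refine hdv.not_ge (hs.deriv_nonpos_of_lt hv1 (fun x hx => ?_) ⟨hv.1.le, le_rfl⟩)
      by_contra! hx'
      exact hφv (hs.le_of_le hx.1 hx' ⟨hx.2, hv1⟩)
  · have hloc : IsLocalMin φ u₀ := hmin.isLocalMin (Icc_mem_nhds h0 (hu.1.trans hu.2))
    have hd0 := hloc.hasDerivAt_eq_zero (hs.hasDerivAt u₀ hu₀)
    exact hs.deriv_nonneg_of_le h0 hle hd0.ge ⟨hu.1.le, hu.2.le⟩

/-- The barrier is the second-order Taylor polynomial of `φ` at `0`, lowered by `0.01` so that every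
comparison is strict. -/
theorem quadratic_le (hs : RiccatiSolution m φ d d') {b : ℝ} (hb : b * (3 * m + 8) ≤ 10.4)
    {u : ℝ} (hu : u ∈ Icc 0 b) :
    0.99 - (4 * m + 2) / 3 * u + 4 * (2 * m + 1) * (m - 1) / 45 * u ^ 2 ≤ φ u := by
  have hm := hs.two_le
  have hb1 : b ≤ 1 := by nlinarith
  set e := 4 * (2 * m + 1) * (m - 1) / 45 with he
  refine image_le_of_deriv_right_lt_deriv_boundary' (a := 0) (b := b)
    (f := fun u => 0.99 - (4 * m + 2) / 3 * u + e * u ^ 2)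
    (f' := fun u => - (4 * m + 2) / 3 + 2 * e * u) (by fun_prop)
    (fun x hx => ?_) (by simp only [hs.zero]; norm_num) (hs.continuousOn le_rfl hb1)
    (fun x hx => (hs.hasDerivAt x ⟨hx.1, hx.2.le.trans hb1⟩).hasDerivWithinAt)
    (fun x hx heq => ?_) hu
  · have := (((hasDerivAt_id x).const_mul ((4 * m + 2) / 3)).const_sub 0.99).add
      ((hasDerivAt_pow 2 x).const_mul e)
    refine HasDerivAt.hasDerivWithinAt ?_
    refine this.congr_deriv ?_
    simp only [Nat.cast_ofNat, Nat.add_one_sub_one, pow_one]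
    ring
  · have hx0 : 0 < x := by
      rcases hx.1.eq_or_lt with h0 | h0
      · rw [← h0, hs.zero] at heq; norm_num at heq
      · exact h0
    have hx1 : x < 1 := hx.2.trans_le hb1
    have hode := hs.ode x ⟨hx.1, hx1.le⟩
    have he0 : 0 < e := by rw [he]; apply div_pos _ (by norm_num); nlinarith
    have hxb : x * (3 * m + 8) ≤ 10.4 := by nlinarith [hx.2]
    have h1 : 0 ≤ (2 * m + 1) / 3 + 3 - e * x := by
      have h45 : 45 * (e * x) = 4 * (2 * m + 1) * ((m - 1) * x) := by rw [he]; ring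
      have : (m - 1) * x ≤ 10.4 / 3 := by nlinarith
      nlinarith
    have h2 : 0 < 0.99 - (2 * m - 2) / 3 * x + 2 * e * x ^ 2 := by
      have h45 : 45 * (2 * e * x ^ 2) = 8 * (2 * m + 1) * ((m - 1) * x ^ 2) := by rw [he]; ring
      nlinarith [sq_nonneg ((m - 1) * x - 1.5), sq_nonneg x]
    have key : 2 * x * (1 - x) * (d x - (-(4 * m + 2) / 3 + 2 * e * x)) =
        e * x ^ 3 * ((2 * m + 1) / 3 + 3 - e * x) +
          0.01 * (0.99 - (2 * m - 2) / 3 * x + 2 * e * x ^ 2) := by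
      rw [mul_sub, hode, ← heq, he]
      ring
    have h3 : 0 < 2 * x * (1 - x) := mul_pos (by linarith) (by linarith)
    have h4 : 0 < 2 * x * (1 - x) * (d x - (-(4 * m + 2) / 3 + 2 * e * x)) := by
      rw [key]; positivity
    linarith [pos_of_mul_pos_right h4 h3.le]

theorem neg_le (hs : RiccatiSolution m φ d d') {u : ℝ} (hu : u ∈ Icc (0 : ℝ) 1) :
    -1.6 ≤ φ u := by
  have hm := hs.two_le
  -- At `φ = -1.6` the Riccati equation gives `2u(1-u)φ' = 0.4 (u(3m+8) - 10.4)`, so beyond `b` the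
  -- constant `-1.6` is a barrier. Up to `b` the quadratic barrier applies; it decreases there, so
  -- its value at `b` is the worst.
  set b := 10.4 / (3 * m + 8) with hb
  have h8 : 0 < 3 * m + 8 := by linarith
  have hb' : b * (3 * m + 8) = 10.4 := div_mul_cancel₀ _ h8.ne'
  have hb0 : 0 < b := by positivity
  have hb1 : b ≤ 1 := by nlinarith
  have hquad : ∀ x ∈ Icc 0 b, -1.59 ≤ φ x := by
    intro x hx
    refine le_trans ?_ (hs.quadratic_le hb'.le hx)
    have hxb : x * (3 * m + 8) ≤ 10.4 := by nlinarith [hx.2]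
    have hend : -1.59 ≤ 0.99 - (4 * m + 2) / 3 * b + 4 * (2 * m + 1) * (m - 1) / 45 * b ^ 2 := by
      rw [hb, ← sub_nonneg]
      have : 0.99 - (4 * m + 2) / 3 * (10.4 / (3 * m + 8)) +
          4 * (2 * m + 1) * (m - 1) / 45 * (10.4 / (3 * m + 8)) ^ 2 - -1.59 =
          (2.58 * 45 * (3 * m + 8) ^ 2 - 15 * (4 * m + 2) * 10.4 * (3 * m + 8) +
            4 * (2 * m + 1) * (m - 1) * 108.16) / (45 * (3 * m + 8) ^ 2) := by
        field_simp; ring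
      rw [this]
      apply div_nonneg _ (by positivity)
      nlinarith [sq_nonneg (m - 10)]
    refine hend.trans ?_
    have hslope : 0 ≤ (4 * m + 2) / 3 - 4 * (2 * m + 1) * (m - 1) / 45 * (b + x) := by
      have h1 : (m - 1) * (b + x) ≤ 20.8 / 3 := by nlinarith [hx.1]
      nlinarith
    nlinarith [mul_nonneg hslope (sub_nonneg.2 hx.2)]
  rcases le_total u b with hub | hub
  · linarith [hquad u ⟨hu.1, hub⟩]
  · refine image_le_of_deriv_right_lt_deriv_boundary' (a := b) (b := 1)
      (f := fun _ => -1.6) (f' := fun _ => 0) continuousOn_const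
      (fun x _ => hasDerivWithinAt_const _ _ _)
      (by linarith [hquad b ⟨hb0.le, le_rfl⟩]) (hs.continuousOn hb0.le le_rfl)
      (fun x hx => (hs.hasDerivAt x ⟨hb0.le.trans hx.1, hx.2.le⟩).hasDerivWithinAt)
      (fun x hx heq => ?_) ⟨hub, hu.2⟩
    have hxb : b < x := lt_of_le_of_ne hx.1 fun h => by
      have := hquad b ⟨hb0.le, le_rfl⟩
      rw [h, ← heq] at this; norm_num at this
    have hode := hs.ode x ⟨hb0.le.trans hx.1, hx.2.le⟩
    rw [← heq] at hode
    have h3 : 0 < 2 * x * (1 - x) := mul_pos (by linarith) (by linarith [hx.2])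
    have h4 : 0 < 2 * x * (1 - x) * d x := by rw [hode]; nlinarith
    exact pos_of_mul_pos_right h4 h3.le

end RiccatiSolution

end LogGas

/-! ### The function `φ` attached to `h`. -/

namespace LogGas

open Set

/-- The rescaled difference of `1 / h` and its large-`m` profile, as a function of `u = 1 - x ^ 2`. -/
noncomputable def profile (m : ℕ) (u : ℝ) : ℝ :=
  4 * m / (hPoly m m).eval (1 - u) - 2 * m * u

/-- The derivative of `profile`. -/
noncomputable def profileDeriv (m : ℕ) (u : ℝ) : ℝ :=
  4 * m * (hPoly m m).derivative.eval (1 - u) / (hPoly m m).eval (1 - u) ^ 2 - 2 * m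

theorem hasDerivAt_eval_one_sub (p : Polynomial ℝ) (u : ℝ) :
    HasDerivAt (fun u => p.eval (1 - u)) (-p.derivative.eval (1 - u)) u := by
  have := (p.hasDerivAt (1 - u)).comp u ((hasDerivAt_id u).const_sub 1)
  simpa [Function.comp_def] using this

theorem riccatiSolution_profile {m : ℕ} (hm : 2 ≤ m) :
    ∃ d', RiccatiSolution m (profile m) (profileDeriv m) d' := by
  have hm0 : 0 < m := by omega
  have hmr : (2 : ℝ) ≤ m := by exact_mod_cast hm
  have hpos : ∀ u ∈ Icc (0 : ℝ) 1, 0 < (hPoly m m).eval (1 - u) := fun u hu =>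
    hPoly_eval_pos hm0 (by linarith [hu.2])
  refine ⟨deriv (profileDeriv m), hmr, fun u hu => ?_, fun u hu => ?_, ?_, ?_, fun u hu => ?_⟩
  · have h1 := (((hasDerivAt_eval_one_sub (hPoly m m) u).inv (hpos u hu).ne').const_mul
      (4 * (m : ℝ))).sub ((hasDerivAt_id u).const_mul (2 * (m : ℝ)))
    refine h1.congr_deriv ?_
    unfold profileDeriv
    ring
  · refine DifferentiableAt.hasDerivAt ?_
    exact (((hasDerivAt_eval_one_sub _ u).differentiableAt.const_mul _).div
      ((hasDerivAt_eval_one_sub _ u).differentiableAt.pow 2)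
      (pow_pos (hpos u hu) 2).ne').sub_const _
  · have := hPoly_ode hm0 1
    have h1 : (hPoly m m).eval 1 = 4 * m := by linarith
    simp only [profile, sub_zero, h1]
    field_simp
    ring
  · have := hPoly_ode hm0 0
    have h1 : (2 * (m : ℝ) - 1) * (hPoly m m).eval 0 = 4 * m := by linarith
    have h2 := hPoly_eval_pos hm0 (le_refl (0 : ℝ))
    simp only [profile, sub_self]
    field_simp
    linarith
  · have h := hPoly_ode hm0 (1 - u)
    have h2 := hpos u hu
    unfold profile profileDeriv
    generalize (hPoly m m).eval (1 - u) = H at h h2 ⊢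
    generalize (hPoly m m).derivative.eval (1 - u) = H' at h ⊢
    have h3 : H ≠ 0 := h2.ne'
    field_simp
    linear_combination 4 * h

theorem one_div_hPoly_eq {m : ℕ} (hm : 0 < m) (u : ℝ) :
    1 / (hPoly m m).eval (1 - u) = (profile m u + 2 * m * u) / (4 * m) := by
  have : (m : ℝ) ≠ 0 := by positivity
  unfold profile
  rw [sub_add_cancel, div_div_cancel_left' (by positivity), one_div]

end LogGas

/-! ### Dirichlet kernels and their primitives. -/

namespace LogGas

open Set Real

/-- The Dirichlet kernel `sin ((2p+1)t) / sin t`. -/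
noncomputable def dirichletKernel (p : ℕ) (t : ℝ) : ℝ :=
  1 + ∑ k ∈ Finset.range p, 2 * cos (2 * (k + 1) * t)

/-- The primitive of the Dirichlet kernel vanishing at `0`. -/
noncomputable def dirichletInt (p : ℕ) (t : ℝ) : ℝ :=
  t + ∑ k ∈ Finset.range p, sin (2 * (k + 1) * t) / (k + 1)

theorem dirichletKernel_mul_sin (p : ℕ) (t : ℝ) :
    dirichletKernel p t * sin t = sin ((2 * p + 1) * t) := by
  induction p with
  | zero => simp [dirichletKernel]
  | succ p ih =>
    have h1 : dirichletKernel (p + 1) t = dirichletKernel p t + 2 * cos (2 * (p + 1) * t) := by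
      simp [dirichletKernel, Finset.sum_range_succ, add_assoc]
    have h2 : sin ((2 * p + 1) * t) = sin (2 * (p + 1) * t - t) := by congr 1; ring
    have h3 : sin ((2 * ((p + 1 : ℕ) : ℝ) + 1) * t) = sin (2 * (p + 1) * t + t) := by
      congr 1; push_cast; ring
    rw [h1, add_mul, ih, h2, h3, sin_sub, sin_add]
    ring

theorem hasDerivAt_dirichletInt (p : ℕ) (t : ℝ) :
    HasDerivAt (dirichletInt p) (dirichletKernel p t) t := by
  refine (hasDerivAt_id t).add (HasDerivAt.fun_sum fun k _ => ?_)
  have h := (((hasDerivAt_id t).const_mul (2 * ((k : ℝ) + 1))).sin).div_const ((k : ℝ) + 1)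
  refine h.congr_deriv ?_
  have : (k : ℝ) + 1 ≠ 0 := by positivity
  simp only [id]
  field_simp

theorem continuous_dirichletInt (p : ℕ) : Continuous (dirichletInt p) := by
  unfold dirichletInt; fun_prop

theorem continuous_dirichletKernel (p : ℕ) : Continuous (dirichletKernel p) := by
  unfold dirichletKernel; fun_prop

theorem dirichletInt_zero (p : ℕ) : dirichletInt p 0 = 0 := by simp [dirichletInt]

theorem dirichletInt_pi_div_two (p : ℕ) : dirichletInt p (π / 2) = π / 2 := by
  unfold dirichletInt
  rw [Finset.sum_eq_zero, add_zero]
  intro k _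
  have : 2 * ((k : ℝ) + 1) * (π / 2) = ((k + 1 : ℕ) : ℝ) * π := by push_cast; ring
  rw [this, sin_nat_mul_pi, zero_div]

/-- The integrand is `(cos 2ps - cos 2(p+1)s) / 2`. This removes the term `2mu` of `4m / H` from
`I`. -/
theorem integral_dirichletKernel_mul_sin_sq {p : ℕ} (hp : 1 ≤ p) :
    ∫ s in (0 : ℝ)..(π / 2), dirichletKernel p s * sin s ^ 2 = 0 := by
  have hp0 : (p : ℝ) ≠ 0 := by positivity
  have hp1 : (p : ℝ) + 1 ≠ 0 := by positivity
  have h : ∀ s ∈ uIcc 0 (π / 2), HasDerivAt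
      (fun s => sin (2 * p * s) / (4 * p) - sin (2 * (p + 1) * s) / (4 * (p + 1)))
      (dirichletKernel p s * sin s ^ 2) s := by
    intro s _
    have h1 := (((hasDerivAt_id s).const_mul (2 * (p : ℝ))).sin).div_const (4 * (p : ℝ))
    have h2 := (((hasDerivAt_id s).const_mul (2 * ((p : ℝ) + 1))).sin).div_const (4 * ((p : ℝ) + 1))
    refine (h1.sub h2).congr_deriv ?_
    have e1 : cos (2 * p * s) = cos ((2 * p + 1) * s - s) := by congr 1; ring
    have e2 : cos (2 * (p + 1) * s) = cos ((2 * p + 1) * s + s) := by congr 1; ring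
    simp only [id]
    rw [sq (sin s), ← mul_assoc (dirichletKernel p s), dirichletKernel_mul_sin, e1, e2, cos_sub, cos_add]
    field_simp
    ring
  rw [intervalIntegral.integral_eq_sub_of_hasDerivAt h
    (((continuous_dirichletKernel p).mul (continuous_sin.pow 2)).intervalIntegrable _ _)]
  have e1 : 2 * (p : ℝ) * (π / 2) = (p : ℝ) * π := by ring
  have e2 : 2 * ((p : ℝ) + 1) * (π / 2) = ((p + 1 : ℕ) : ℝ) * π := by push_cast; ring
  rw [e1, e2, sin_nat_mul_pi, sin_nat_mul_pi]
  simp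

/-- The correction cancels the oscillating kernel; `c = 1` and `c = -1` then make the function
antitone and monotone up to `π / 2`. Comparison with the value at `π / 2` bounds the primitive. -/
theorem hasDerivAt_dirichletInt_add (p : ℕ) (c : ℝ) {t : ℝ} (ht : sin t ≠ 0) :
    HasDerivAt (fun t => dirichletInt p t + (cos ((2 * p + 1) * t) + c) / ((2 * p + 1) * sin t))
      (-((cos ((2 * p + 1) * t) + c) * cos t / ((2 * p + 1) * sin t ^ 2))) t := by
  have hq : (2 * (p : ℝ) + 1) ≠ 0 := by positivity
  have h1 := (((hasDerivAt_id t).const_mul (2 * (p : ℝ) + 1)).cos.add_const c).div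
    ((hasDerivAt_sin t).const_mul (2 * (p : ℝ) + 1)) (mul_ne_zero hq ht)
  refine ((hasDerivAt_dirichletInt p t).add h1).congr_deriv ?_
  have h2 := dirichletKernel_mul_sin p t
  simp only [id]
  rw [← h2]
  field_simp
  ring

theorem abs_dirichletInt_sub_le (p : ℕ) {t : ℝ} (ht : t ∈ Ioc 0 (π / 2)) :
    |dirichletInt p t - π / 2| ≤ 2 / ((2 * p + 1) * sin t) - 1 / (2 * p + 1) := by
  have hq : 0 < (2 * (p : ℝ) + 1) := by positivity
  have hsin : ∀ x ∈ Icc t (π / 2), 0 < sin x := fun x hx =>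
    sin_pos_of_pos_of_lt_pi (ht.1.trans_le hx.1) (by linarith [hx.2, pi_pos])
  have hcos : ∀ x ∈ Icc t (π / 2), 0 ≤ cos x := fun x hx =>
    cos_nonneg_of_neg_pi_div_two_le_of_le (by linarith [hx.1, ht.1, pi_pos]) hx.2
  have hend : cos ((2 * p + 1) * (π / 2)) = 0 := by
    rw [cos_eq_zero_iff]; exact ⟨p, by push_cast; ring⟩
  have hder : ∀ c, ∀ x ∈ Icc t (π / 2), HasDerivAt _ _ x := fun c x hx =>
    hasDerivAt_dirichletInt_add p c (hsin x hx).ne'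
  have hcont : ∀ c, ContinuousOn (fun t => dirichletInt p t +
      (cos ((2 * p + 1) * t) + c) / ((2 * p + 1) * sin t)) (Icc t (π / 2)) := fun c x hx =>
    (hder c x hx).continuousAt.continuousWithinAt
  have hanti : AntitoneOn (fun t => dirichletInt p t +
      (cos ((2 * p + 1) * t) + 1) / ((2 * p + 1) * sin t)) (Icc t (π / 2)) := by
    refine antitoneOn_of_deriv_nonpos (convex_Icc _ _) (hcont 1) ?_ ?_
    · exact fun x hx => (hder 1 x (interior_subset hx)).differentiableAt.differentiableWithinAt
    · intro x hx
      rw [(hder 1 x (interior_subset hx)).deriv, neg_nonpos]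
      have := hcos x (interior_subset hx)
      have := neg_one_le_cos ((2 * p + 1) * x)
      exact div_nonneg (mul_nonneg (by linarith) ‹_›) (by positivity)
  have hmono : MonotoneOn (fun t => dirichletInt p t +
      (cos ((2 * p + 1) * t) + -1) / ((2 * p + 1) * sin t)) (Icc t (π / 2)) := by
    refine monotoneOn_of_deriv_nonneg (convex_Icc _ _) (hcont (-1)) ?_ ?_
    · exact fun x hx => (hder (-1) x (interior_subset hx)).differentiableAt.differentiableWithinAt
    · intro x hx
      rw [(hder (-1) x (interior_subset hx)).deriv, neg_nonneg]
      have := hcos x (interior_subset hx)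
      have := cos_le_one ((2 * p + 1) * x)
      exact div_nonpos_of_nonpos_of_nonneg (mul_nonpos_of_nonpos_of_nonneg (by linarith) ‹_›)
        (by positivity)
  have hl := left_mem_Icc.2 ht.2
  have hr := right_mem_Icc.2 ht.2
  have h1 := hanti hl hr ht.2
  have h2 := hmono hl hr ht.2
  simp only [hend, dirichletInt_pi_div_two, sin_pi_div_two, mul_one, zero_add] at h1 h2
  have hs := hsin t hl
  have h3 : (cos ((2 * p + 1) * t) + 1) / ((2 * p + 1) * sin t) ≤ 2 / ((2 * p + 1) * sin t) := by
    have := cos_le_one ((2 * p + 1) * t)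
    gcongr; linarith
  have h4 : -(2 / ((2 * p + 1) * sin t)) ≤
      (cos ((2 * p + 1) * t) + -1) / ((2 * p + 1) * sin t) := by
    have := neg_one_le_cos ((2 * p + 1) * t)
    rw [← neg_div]
    gcongr; linarith
  rw [neg_div] at h2
  rw [abs_le]
  constructor <;> linarith

/-- This form is chosen so that at `x = π / q` it gives exactly `2 / (q sin x) ≤ 2 / π + 1 / q`; the
range covers `π / q ≤ π / 3`. -/
theorem two_mul_div_two_add_le_sin {x : ℝ} (hx : 0 ≤ x) (hx' : x ≤ 1.1) :
    2 * x / (2 + x) ≤ sin x := by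
  refine le_trans ?_ (sin_ge_sub_cube hx)
  rw [div_le_iff₀ (by linarith)]
  have : 0 ≤ x ^ 2 * (1 - x / 3 - x ^ 2 / 6) := mul_nonneg (sq_nonneg x) (by nlinarith)
  nlinarith

/-- The integrals of the Dirichlet kernels over `[0, t]` lie between `0` and `π / 2 + 2 / π`. -/
theorem dirichletInt_mem_Icc {p : ℕ} (hp : 1 ≤ p) {t : ℝ} (ht : t ∈ Icc 0 (π / 2)) :
    dirichletInt p t ∈ Icc 0 (π / 2 + 2 / π) := by
  have hπ := pi_gt_three
  have hπ' := pi_lt_d2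
  have hpr : (1 : ℝ) ≤ p := by exact_mod_cast hp
  have hq : 0 < (2 * (p : ℝ) + 1) := by positivity
  set q := 2 * (p : ℝ) + 1 with hqd
  have hx0 : 0 < π / q := by positivity
  have hx1 : π / q ≤ 1.1 := by rw [div_le_iff₀ hq]; linarith
  have hx2 : π / q ≤ π / 2 := by linarith
  have hsinq : 2 / (q * sin (π / q)) - 1 / q ≤ 2 / π := by
    have h1 := two_mul_div_two_add_le_sin hx0.le hx1
    have h2 : 2 / (q * sin (π / q)) ≤ 2 / (q * (2 * (π / q) / (2 + π / q))) := by gcongr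
    have h3 : 2 / (q * (2 * (π / q) / (2 + π / q))) = 2 / π + 1 / q := by field_simp
    linarith
  have hfar : ∀ x ∈ Icc (π / q) (π / 2), |dirichletInt p x - π / 2| ≤ 2 / π := by
    intro x hx
    refine (abs_dirichletInt_sub_le p ⟨hx0.trans_le hx.1, hx.2⟩).trans (le_trans ?_ hsinq)
    have : sin (π / q) ≤ sin x := sin_le_sin_of_le_of_le_pi_div_two (by linarith) hx.2 hx.1
    have h0 : 0 < sin (π / q) := sin_pos_of_pos_of_lt_pi hx0 (by linarith)
    gcongr
  have h2π : 2 / π ≤ π / 2 := by rw [div_le_div_iff₀ pi_pos two_pos]; nlinarith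
  rcases le_total (π / q) t with h | h
  · have := abs_le.1 (hfar t ⟨h, ht.2⟩)
    constructor <;> linarith
  -- Up to its first zero `π / q` the kernel is nonnegative, so the primitive stays between `0` and
  -- its value at `π / q`.
  · have hmono : MonotoneOn (dirichletInt p) (Icc 0 (π / q)) := by
      refine monotoneOn_of_deriv_nonneg (convex_Icc _ _) (continuous_dirichletInt p).continuousOn
        (fun x _ => (hasDerivAt_dirichletInt p x).differentiableAt.differentiableWithinAt) ?_
      intro x hx
      rw [interior_Icc] at hx
      rw [(hasDerivAt_dirichletInt p x).deriv]
      have h0 : 0 < sin x := sin_pos_of_pos_of_lt_pi hx.1 (by linarith [hx.2])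
      have h1 : 0 ≤ sin ((2 * p + 1) * x) := by
        refine sin_nonneg_of_nonneg_of_le_pi (mul_nonneg hq.le hx.1.le) ?_
        have := (lt_div_iff₀ hq).1 hx.2
        linarith
      rw [← dirichletKernel_mul_sin] at h1
      exact nonneg_of_mul_nonneg_left h1 h0
    have hq2 := abs_le.1 (hfar _ ⟨le_rfl, hx2⟩)
    have h1 := hmono (left_mem_Icc.2 hx0.le) ⟨ht.1, h⟩ ht.1
    have h2 := hmono ⟨ht.1, h⟩ (right_mem_Icc.2 hx0.le) h
    rw [dirichletInt_zero] at h1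
    exact ⟨h1, by linarith⟩

end LogGas

/-! ### The uniform bound on `Q`. -/

namespace LogGas

open Set Real

/-- A weighted total-variation estimate for a function that decreases on `[a, c]` and increases
on `[c, b]`. -/
theorem integral_mul_deriv_mem_Icc_of_unimodal {S g g' : ℝ → ℝ} {a b c C : ℝ} (hac : a ≤ c)
    (hcb : c ≤ b) (hg : ∀ x ∈ Icc a b, HasDerivAt g (g' x) x) (hg' : ContinuousOn g' (Icc a b))
    (hS : ContinuousOn S (Icc a b)) (hSC : ∀ x ∈ Icc a b, S x ∈ Icc 0 C)
    (h1 : ∀ x ∈ Ioo a c, g' x ≤ 0) (h2 : ∀ x ∈ Ioo c b, 0 ≤ g' x) :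
    ∫ x in a..b, S x * g' x ∈ Icc (C * (g c - g a)) (C * (g b - g c)) := by
  have hs1 : Icc a c ⊆ Icc a b := Icc_subset_Icc_right hcb
  have hs2 : Icc c b ⊆ Icc a b := Icc_subset_Icc_left hac
  have hi1 : IntervalIntegrable (fun x => S x * g' x) MeasureTheory.volume a c :=
    ((hS.mul hg').mono hs1).intervalIntegrable_of_Icc hac
  have hi2 : IntervalIntegrable (fun x => S x * g' x) MeasureTheory.volume c b :=
    ((hS.mul hg').mono hs2).intervalIntegrable_of_Icc hcb
  have hj1 : IntervalIntegrable g' MeasureTheory.volume a c :=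
    (hg'.mono hs1).intervalIntegrable_of_Icc hac
  have hj2 : IntervalIntegrable g' MeasureTheory.volume c b :=
    (hg'.mono hs2).intervalIntegrable_of_Icc hcb
  have hf1 : ∫ x in a..c, C * g' x = C * (g c - g a) := by
    rw [intervalIntegral.integral_const_mul, intervalIntegral.integral_eq_sub_of_hasDerivAt _ hj1]
    exact fun x hx => hg x (hs1 (by rwa [uIcc_of_le hac] at hx))
  have hf2 : ∫ x in c..b, C * g' x = C * (g b - g c) := by
    rw [intervalIntegral.integral_const_mul, intervalIntegral.integral_eq_sub_of_hasDerivAt _ hj2]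
    exact fun x hx => hg x (hs2 (by rwa [uIcc_of_le hcb] at hx))
  rw [← intervalIntegral.integral_add_adjacent_intervals hi1 hi2, ← hf1, ← hf2]
  have k1 : ∫ x in a..c, C * g' x ≤ ∫ x in a..c, S x * g' x :=
    intervalIntegral.integral_mono_on_of_le_Ioo hac (hj1.const_mul C) hi1 fun x hx =>
      mul_le_mul_of_nonpos_right (hSC x (hs1 (Ioo_subset_Icc_self hx))).2 (h1 x hx)
  have k2 : ∫ x in a..c, S x * g' x ≤ ∫ x in a..c, (0 : ℝ) :=
    intervalIntegral.integral_mono_on_of_le_Ioo hac hi1 (by simp) fun x hx =>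
      mul_nonpos_of_nonneg_of_nonpos (hSC x (hs1 (Ioo_subset_Icc_self hx))).1 (h1 x hx)
  have k3 : ∫ x in c..b, S x * g' x ≤ ∫ x in c..b, C * g' x :=
    intervalIntegral.integral_mono_on_of_le_Ioo hcb hi2 (hj2.const_mul C) fun x hx =>
      mul_le_mul_of_nonneg_right (hSC x (hs2 (Ioo_subset_Icc_self hx))).2 (h2 x hx)
  have k4 : ∫ x in c..b, (0 : ℝ) ≤ ∫ x in c..b, S x * g' x :=
    intervalIntegral.integral_mono_on_of_le_Ioo hcb (by simp) hi2 fun x hx =>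
      mul_nonneg (hSC x (hs2 (Ioo_subset_Icc_self hx))).1 (h2 x hx)
  rw [intervalIntegral.integral_zero] at k2 k4
  constructor <;> linarith

theorem sin_sq_mem_Icc (s : ℝ) : sin s ^ 2 ∈ Icc (0 : ℝ) 1 := ⟨sq_nonneg _, sin_sq_le_one s⟩

theorem hasDerivAt_profile_sin_sq {m : ℕ} (hm : 2 ≤ m) (s : ℝ) :
    HasDerivAt (fun s => profile m (sin s ^ 2))
      (profileDeriv m (sin s ^ 2) * (2 * sin s * cos s)) s := by
  obtain ⟨d', hs⟩ := riccatiSolution_profile hm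
  have h1 := (hasDerivAt_sin s).fun_pow 2
  have h2 := (hs.hasDerivAt _ (sin_sq_mem_Icc s)).comp s h1
  refine h2.congr_deriv ?_
  simp

theorem continuous_profileDeriv_sin_sq {m : ℕ} (hm : 2 ≤ m) :
    Continuous fun s => profileDeriv m (sin s ^ 2) * (2 * sin s * cos s) := by
  obtain ⟨d', hs⟩ := riccatiSolution_profile hm
  refine Continuous.mul ?_ (by fun_prop)
  refine continuous_iff_continuousAt.2 fun s => ?_
  exact ContinuousAt.comp (f := fun s => sin s ^ 2)
    (hs.hasDerivAt_deriv _ (sin_sq_mem_Icc s)).continuousAt (by fun_prop)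

/-- `Q` as a weighted integral of the derivative of the profile. -/
theorem Q_eq_integral {m p : ℕ} (hm : 2 ≤ m) (hp : 1 ≤ p) :
    Q m (2 * (p : ℤ) + 1) = -(1 / (π * m)) * ∫ s in (0 : ℝ)..(π / 2),
      dirichletInt p s * (profileDeriv m (sin s ^ 2) * (2 * sin s * cos s)) := by
  have hm0 : (m : ℝ) ≠ 0 := by positivity
  obtain ⟨d', hs⟩ := riccatiSolution_profile hm
  have hK := continuous_dirichletKernel p
  have hφ : Continuous fun s => profile m (sin s ^ 2) :=
    continuous_iff_continuousAt.2 fun s => (hasDerivAt_profile_sin_sq hm s).continuousAt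
  have hI : (∫ s in (0 : ℝ)..(π / 2),
      sin (((2 * (p : ℤ) + 1 : ℤ) : ℝ) * s) / (sin s * h m (cos s))) =
      ∫ s in (0 : ℝ)..(π / 2), (1 / (4 * m) * (dirichletKernel p s * profile m (sin s ^ 2)) +
        1 / 2 * (dirichletKernel p s * sin s ^ 2)) := by
    rw [intervalIntegral.integral_of_le (by positivity),
      intervalIntegral.integral_of_le (by positivity)]
    refine MeasureTheory.setIntegral_congr_fun measurableSet_Ioc fun s hs => ?_
    have h0 : sin s ≠ 0 :=
      (sin_pos_of_pos_of_lt_pi hs.1 (by linarith [hs.2, pi_pos])).ne'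
    have h1 : cos s ^ 2 = 1 - sin s ^ 2 := by rw [sin_sq]; ring
    have h2 := one_div_hPoly_eq (m := m) (by omega) (sin s ^ 2)
    have h3 := dirichletKernel_mul_sin p s
    push_cast
    rw [h_eq_eval_hPoly, h1, ← h3, mul_comm, mul_div_mul_left _ _ h0, div_eq_mul_one_div, h2]
    field_simp
    ring
  -- The boundary term is `(π / 2) * φ 1 = -π / 2`; after scaling it accounts for the summand `1 /
  -- (2m)` of `Q`.
  have hparts := intervalIntegral.integral_mul_deriv_eq_deriv_mul (a := 0) (b := π / 2)
    (fun s _ => hasDerivAt_dirichletInt p s) (fun s _ => hasDerivAt_profile_sin_sq hm s)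
    (hK.intervalIntegrable _ _) ((continuous_profileDeriv_sin_sq hm).intervalIntegrable _ _)
  rw [dirichletInt_pi_div_two, dirichletInt_zero, sin_pi_div_two, one_pow, hs.one] at hparts
  have hi1 : IntervalIntegrable (fun s => 1 / (4 * m) *
      (dirichletKernel p s * profile m (sin s ^ 2))) MeasureTheory.volume 0 (π / 2) :=
    ((hK.mul hφ).intervalIntegrable _ _).const_mul _
  have hi2 : IntervalIntegrable (fun s => 1 / 2 * (dirichletKernel p s * sin s ^ 2))
      MeasureTheory.volume 0 (π / 2) :=
    ((hK.mul (continuous_sin.pow 2)).intervalIntegrable _ _).const_mul _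
  rw [hparts, Q, I_eq _ _ ⟨p, rfl⟩, hI, intervalIntegral.integral_add hi1 hi2,
    intervalIntegral.integral_const_mul, intervalIntegral.integral_const_mul,
    integral_dirichletKernel_mul_sin_sq hp]
  have := pi_ne_zero
  field_simp
  ring

theorem abs_Q_le {m p : ℕ} (hm : 2 ≤ m) (hp : 1 ≤ p) :
    |Q m (2 * (p : ℤ) + 1)| ≤ 1.827 / m := by
  have hm0 : (0 : ℝ) < m := by positivity
  obtain ⟨d', hs⟩ := riccatiSolution_profile hm
  obtain ⟨u₀, hu₀, hdec, hinc⟩ := hs.exists_unimodal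
  -- The angle with `sin² c = u₀`, where `φ(sin² s)` turns from decreasing to increasing.
  set c := arcsin (√u₀) with hc
  have hsq1 : √u₀ ≤ 1 := sqrt_le_one.2 hu₀.2
  have hc0 : 0 ≤ c := arcsin_nonneg.2 (sqrt_nonneg _)
  have hc1 : c ≤ π / 2 := arcsin_le_pi_div_two _
  have hsc : sin c ^ 2 = u₀ := by
    rw [hc, sin_arcsin (by linarith [sqrt_nonneg u₀]) hsq1, sq_sqrt hu₀.1]
  have hsin : ∀ x ∈ Icc 0 (π / 2), 0 ≤ sin x := fun x hx =>
    sin_nonneg_of_nonneg_of_le_pi hx.1 (by linarith [hx.2, pi_pos])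
  have hcos : ∀ x ∈ Icc 0 (π / 2), 0 ≤ 2 * sin x * cos x := fun x hx =>
    mul_nonneg (mul_nonneg two_pos.le (hsin x hx))
      (cos_nonneg_of_neg_pi_div_two_le_of_le (by linarith [hx.1, pi_pos]) hx.2)
  have hlt : ∀ x y, 0 ≤ x → x < y → y ≤ π / 2 → sin x ^ 2 < sin y ^ 2 := fun x y hx hxy hy =>
    pow_lt_pow_left₀ (sin_lt_sin_of_lt_of_le_pi_div_two (by linarith [pi_pos]) hy hxy)
      (hsin x ⟨hx, hxy.le.trans hy⟩) two_ne_zero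
  have hint := integral_mul_deriv_mem_Icc_of_unimodal hc0 hc1
    (fun x _ => hasDerivAt_profile_sin_sq hm x) (continuous_profileDeriv_sin_sq hm).continuousOn
    (continuous_dirichletInt p).continuousOn (fun x hx => dirichletInt_mem_Icc hp hx)
    (fun x hx => mul_nonpos_of_nonpos_of_nonneg (hdec _ ⟨by
      simpa using hlt 0 x le_rfl hx.1 (hx.2.le.trans hc1), hsc ▸ hlt x c hx.1.le hx.2 hc1⟩)
      (hcos x ⟨hx.1.le, hx.2.le.trans hc1⟩))
    (fun x hx => mul_nonneg (hinc _ ⟨hsc ▸ hlt c x hc0 hx.1 hx.2.le, by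
      simpa using hlt x (π / 2) (hc0.trans hx.1.le) hx.2 le_rfl⟩)
      (hcos x ⟨hc0.trans hx.1.le, hx.2.le⟩))
  have hmin := hs.neg_le hu₀
  simp only [hsc, sin_zero, sin_pi_div_two, one_pow, ne_eq, OfNat.ofNat_ne_zero, not_false_eq_true,
    zero_pow, hs.zero, hs.one] at hint
  rw [Q_eq_integral hm hp]
  set J := ∫ s in (0 : ℝ)..(π / 2),
    dirichletInt p s * (profileDeriv m (sin s ^ 2) * (2 * sin s * cos s))
  have hπ := pi_gt_d4
  have hC : 0 ≤ π / 2 + 2 / π := by positivity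
  -- The factor `2.6 = 1 - (-1.6)` bounds the fall of `φ`; its later rise is at most `0.6`.
  have hCπ : 2.6 * (π / 2 + 2 / π) ≤ 1.827 * π := by
    have : 2 / π * π = 2 := div_mul_cancel₀ _ pi_ne_zero
    have h2 : 2 / π ≤ 0.2026923 * π := by
      rw [div_le_iff₀ pi_pos]; nlinarith
    linarith
  have hJ : |J| ≤ 1.827 * π := by
    rw [abs_le]
    constructor <;> nlinarith [hint.1, hint.2]
  rw [abs_mul, abs_neg, abs_of_pos (by positivity)]
  calc 1 / (π * m) * |J| ≤ 1 / (π * m) * (1.827 * π) := by gcongr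
    _ = 1.827 / m := by
      have := pi_ne_zero
      field_simp

end LogGas

/-! ### Assembly of the determinant bound. -/

namespace LogGas

theorem abs_matQ_le {m : ℕ} (hm : 2 ≤ m) (i j : Fin (m - 1)) : |matQ m i j| ≤ 1.827 / m := by
  have hi := i.2
  -- Since `i ≤ m - 2`, every argument of `Q` is `2p + 1` with `p ≥ 1`, as `abs_Q_le` requires.
  obtain ⟨p, hp⟩ : ∃ p : ℕ, (p : ℤ) = (m : ℤ) - 1 - i + j := ⟨m - 1 - i + j, by omega⟩
  have hq : (2 * (m : ℤ) - 1) - 2 * (((i : ℕ) : ℤ) + 1) + 2 * (((j : ℕ) : ℤ) + 1) =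
      2 * (p : ℤ) + 1 := by rw [hp]; ring
  rw [matQ, Matrix.of_apply, hq]
  exact abs_Q_le hm (by omega)

theorem sum_matB (m : ℕ) (j : Fin (m - 1)) :
    ∑ l, matB m l j = 2 * m * ∑ k ∈ Finset.range (j + 1), ((2 * m - 1).choose k : ℝ) := by
  have h1 := Fin.sum_univ_eq_sum_range (fun l : ℕ => 2 * (m : ℝ) *
    (if l ≤ (j : ℕ) then (((2 * m - 1).choose ((j : ℕ) - l) : ℕ) : ℝ) else 0)) (m - 1)
  refine Eq.trans h1 ?_
  rw [← Finset.mul_sum, ← Finset.sum_filter]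
  congr 1
  have h2 : (Finset.range (m - 1)).filter (· ≤ (j : ℕ)) = Finset.range (j + 1) := by
    ext l
    have := j.2
    simp only [Finset.mem_filter, Finset.mem_range]
    omega
  rw [h2, ← Finset.sum_range_reflect]
  refine Finset.sum_congr rfl fun l hl => ?_
  have := Finset.mem_range.1 hl
  congr 2
  omega

theorem matB_nonneg (m : ℕ) (i j : Fin (m - 1)) : 0 ≤ matB m i j := by
  rw [matB, Matrix.of_apply]
  split_ifs <;> positivity

theorem factorial_sq_div_eq {m : ℕ} (hm : 1 ≤ m) :
    ((Nat.factorial m : ℝ) ^ 2) / ((m : ℝ) * (Nat.factorial (2 * m) : ℝ)) =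
      1 / (m * ((2 * m).choose m : ℝ)) := by
  have h := Nat.choose_mul_factorial_mul_factorial (show m ≤ 2 * m by omega)
  rw [show 2 * m - m = m by omega] at h
  have h' : ((2 * m).choose m : ℝ) * m.factorial * m.factorial = (2 * m).factorial := by
    exact_mod_cast h
  have h1 : (m.factorial : ℝ) ≠ 0 := by positivity
  have h2 : (m : ℝ) ≠ 0 := by positivity
  have h3 : ((2 * m).choose m : ℝ) ≠ 0 := by
    exact_mod_cast (Nat.choose_pos (show m ≤ 2 * m by omega)).ne'
  rw [← h']
  field_simp

end LogGas

theorem theorem1 (m : ℕ) (hm : 2 ≤ m) : (LogGas.matT m).det ≥ 0.0865 := by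
  have hm0 : (0 : ℝ) < m := by positivity
  have hch : (0 : ℝ) < (2 * m).choose m := by
    exact_mod_cast Nat.choose_pos (show m ≤ 2 * m by omega)
  set r : ℝ := 1 / (m * ((2 * m).choose m : ℝ)) with hr
  have hr0 : 0 < r := by positivity
  let w : Fin (m - 1) → ℝ := fun j => r * (1.827 / m * ∑ l, LogGas.matB m l j)
  have hK : ∀ i j, |(r • (LogGas.matQ m * LogGas.matB m)) i j| ≤ w j := by
    intro i j
    rw [Matrix.smul_apply, smul_eq_mul, abs_mul, abs_of_pos hr0, Matrix.mul_apply]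
    simp only [w]
    rw [Finset.mul_sum]
    refine mul_le_mul_of_nonneg_left ((Finset.abs_sum_le_sum_abs _ _).trans
      (Finset.sum_le_sum fun l _ => ?_)) hr0.le
    rw [abs_mul, abs_of_nonneg (LogGas.matB_nonneg m l j)]
    exact mul_le_mul_of_nonneg_right (LogGas.abs_matQ_le hm i l) (LogGas.matB_nonneg m l j)
  -- All powers of `m` and the central binomial coefficient cancel, leaving `1.827 / 2`.
  have hw : ∑ j, w j ≤ 0.9135 := by
    have h1 : ∑ j, w j = r * (1.827 / m * (2 * m * ∑ j ∈ Finset.range (m - 1),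
        ∑ k ∈ Finset.range (j + 1), ((2 * m - 1).choose k : ℝ))) := by
      simp only [w, LogGas.sum_matB]
      rw [← Finset.mul_sum, ← Finset.mul_sum, ← Finset.mul_sum,
        Fin.sum_univ_eq_sum_range
          (fun j => ∑ k ∈ Finset.range (j + 1), ((2 * m - 1).choose k : ℝ))]
    rw [h1]
    calc _ ≤ r * (1.827 / m * (2 * m * (m / 4 * ((2 * m).choose m : ℝ)))) := by
          gcongr
          exact Nat.sum_range_sum_range_choose_le m (by omega)
      _ = 0.9135 := by
          rw [hr]
          field_simp
          norm_num
  have := Matrix.one_sub_sum_le_det_one_sub (m - 1) _ w hK (hw.trans_lt (by norm_num))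
  rw [LogGas.matT, LogGas.factorial_sq_div_eq (by omega), ← hr, ge_iff_le]
  refine le_trans ?_ this
  linarith
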